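/- Let $G$ be a finite oriented graph drawn in the plane $\mathbb C$ with polygonal links that meet only at vertices. Suppose that $G$ is balanced (at every vertex the number of incoming links equals the number of outgoing links) and that every face of $G$ is oriented: either all links on its border have the face on their left (the face is anticlockwise, $+$), or all of them have it on their right (the face is clockwise, $-$). A *circuit* is a nonempty closed walk that follows links along their orientation and uses no link twice. Its *winding number* around a point not on it is the total variation of the argument divided by $2\pi$; the *inside* of the circuit is the set of points off it around which its winding number is nonzero. A circuit has *orientation* $\varepsilon\in\{+1,-1\}$ ($+1$: anticlockwise, $-1$: clockwise) if its inside is nonempty and its winding number around every point of its inside equals $\varepsilon$. (Every simple closed circuit has an orientation in this sense.) Let $\mathcal C_1$ and $\mathcal C_2$ be circuits of $G$ without a common link, with orientations $\varepsilon_1$ and $\varepsilon_2$, nested in the sense that the inside of $\mathcal C_1$ is contained in the inside of $\mathcal C_2$. Let the interface graph $\mathbf I$ consist of all links of $G$ that lie strictly between them: apart from their end points, they run off $\mathcal C_1$ and its inside, and in the inside of $\mathcal C_2$. (Links of $\mathcal C_1$ and $\mathcal C_2$ do not belong to $\mathbf I$.) The *circulation* of $\mathbf I$ around a point not on $\mathbf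 I$ is the sum of the variations of the argument along all its oriented links, divided by $2\pi$. An *Eulerian circuit* of $\mathbf I$ is a circuit that uses exactly the links of $\mathbf I$. Let $F$ be a central face of $\mathbf I$, i.e. a connected component of the complement of $\mathbf I$ that meets the inside of $\mathcal C_1$. Then: 1. If $\varepsilon_1=\varepsilon_2$, then around every point of $F$ the circulation of $\mathbf I$ is $-\varepsilon_1$, and every Eulerian circuit of $\mathbf I$ has winding number $-\varepsilon_1$; that is, it winds around the central face, with orientation opposite to that of $\mathcal C_1$ and $\mathcal C_2$. 2. If $\varepsilon_1=-\varepsilon_2$, then around every point of $F$ the circulation of $\mathbf I$ is $0$, and every Eulerian circuit of $\mathbf I$ has winding number $0$; that is, no Eulerian circuit of $\mathbf I$ winds around the central face. -/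

import Mathlib

/-- An oriented graph drawn in the plane `ℂ` (a plane graph with polygonal links).
`V` indexes the vertices and `E` the links.  The link `e` is the oriented polygonal arc with
consecutive corners `pt e 0, pt e 1, …, pt e (len e)`, running from its source vertex to its
target vertex.  A point of the arc other than its two end points is written uniquely as the point
at parameter `t ∈ [0, 1)` of the `i`-th segment, with `(i, t) ≠ (0, 0)`. -/
structure PlaneDigraph (V E : Type*) where
  pos : V → ℂ
  pos_injective : Function.Injective pos
  src : E → V
  tgt : E → V
  len : E → ℕ
  pt : E → ℕ → ℂ
  len_pos : ∀ e, 0 < len e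
  pt_zero : ∀ e, pt e 0 = pos (src e)
  pt_len : ∀ e, pt e (len e) = pos (tgt e)
  /-- Links do not cross themselves or one another. -/
  inner_injective : ∀ (e e' : E) (i i' : ℕ) (t t' : ℝ),
    i < len e → t ∈ Set.Ico (0 : ℝ) 1 → 0 < (i : ℝ) + t →
    i' < len e' → t' ∈ Set.Ico (0 : ℝ) 1 → 0 < (i' : ℝ) + t' →
    AffineMap.lineMap (pt e i) (pt e (i + 1)) t
      = AffineMap.lineMap (pt e' i') (pt e' (i' + 1)) t' →
    e = e' ∧ i = i' ∧ t = t'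
  /-- Links meet vertices only at their end points. -/
  inner_ne_vertex : ∀ (e : E) (i : ℕ) (t : ℝ) (v : V),
    i < len e → t ∈ Set.Ico (0 : ℝ) 1 → 0 < (i : ℝ) + t →
    AffineMap.lineMap (pt e i) (pt e (i + 1)) t ≠ pos v

namespace PlaneDigraph

variable {V E : Type*} (G : PlaneDigraph V E)

/-- The set of all points of the link `e`, end points included. -/
def arc (e : E) : Set ℂ :=
  {z | ∃ i, i < G.len e ∧ z ∈ segment ℝ (G.pt e i) (G.pt e (i + 1))}

/-- The link `e` without its two end points. -/
def openArc (e : E) : Set ℂ :=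
  {z | ∃ (i : ℕ) (t : ℝ), i < G.len e ∧ t ∈ Set.Ico (0 : ℝ) 1 ∧ 0 < (i : ℝ) + t ∧
    z = AffineMap.lineMap (G.pt e i) (G.pt e (i + 1)) t}

/-- The point set of the subgraph formed by a set of links. -/
def support (S : Set E) : Set ℂ := ⋃ e ∈ S, G.arc e

/-- `F` is a face of the subgraph formed by the links in `S`: a connected component of the
complement of its point set. -/
def IsFace (S : Set E) (F : Set ℂ) : Prop :=
  ∃ p ∈ (G.support S)ᶜ, F = connectedComponentIn (G.support S)ᶜ p

/-- The region `F` touches the link `e` from the left of `e` (with respect to its orientation). -/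
def LiesLeft (F : Set ℂ) (e : E) : Prop :=
  ∃ i, i < G.len e ∧ ∃ m ∈ openSegment ℝ (G.pt e i) (G.pt e (i + 1)),
    ∃ δ > (0 : ℝ), ∀ t : ℝ, 0 < t → t < δ →
      m + (t : ℂ) * Complex.I * (G.pt e (i + 1) - G.pt e i) ∈ F

/-- The region `F` touches the link `e` from the right of `e`. -/
def LiesRight (F : Set ℂ) (e : E) : Prop :=
  ∃ i, i < G.len e ∧ ∃ m ∈ openSegment ℝ (G.pt e i) (G.pt e (i + 1)),
    ∃ δ > (0 : ℝ), ∀ t : ℝ, 0 < t → t < δ →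
      m - (t : ℂ) * Complex.I * (G.pt e (i + 1) - G.pt e i) ∈ F

/-- Every face of the graph has an orientation (colour): either all links on its border keep it on
their left, or all of them keep it on their right. -/
def FacesOriented : Prop :=
  ∀ F, G.IsFace Set.univ F → (∀ e, ¬ G.LiesRight F e) ∨ (∀ e, ¬ G.LiesLeft F e)

/-- At every vertex, as many links come in as go out. -/
def IsBalanced : Prop :=
  ∀ v, Nat.card {e // G.tgt e = v} = Nat.card {e // G.src e = v}

/-- The variation of the argument of `z - p` as `z` runs along the link `e`. -/
noncomputable def linkAngle (p : ℂ) (e : E) : ℝ :=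
  ∑ i ∈ Finset.range (G.len e), Complex.arg ((G.pt e (i + 1) - p) / (G.pt e i - p))

/-- A circuit: a nonempty closed walk along oriented links that uses no link twice
(vertices may be visited several times). -/
def IsCircuit (γ : List E) : Prop :=
  γ.Nodup ∧ γ.IsChain (fun e f => G.tgt e = G.src f) ∧
    ∃ h : γ ≠ [], G.tgt (γ.getLast h) = G.src (γ.head h)

/-- The point set of a walk. -/
def walkSupport (γ : List E) : Set ℂ := G.support {e | e ∈ γ}

/-- The winding number of a closed walk around `p`, anticlockwise turns counted positively. -/
noncomputable def windingNumber (γ : List E) (p : ℂ) : ℝ :=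
  (γ.map (G.linkAngle p)).sum / (2 * Real.pi)

open Classical in
/-- The winding number around `p` of the oriented subgraph formed by the links in `S`. -/
noncomputable def graphWindingNumber [Fintype E] (S : Set E) (p : ℂ) : ℝ :=
  (∑ e : E, if e ∈ S then G.linkAngle p e else 0) / (2 * Real.pi)

/-- The points surrounded by the circuit `C`. -/
def inside (C : List E) : Set ℂ := {p | p ∉ G.walkSupport C ∧ G.windingNumber C p ≠ 0}

/-- The points neither on the circuit `C` nor surrounded by it. -/
def outside (C : List E) : Set ℂ := {p | p ∉ G.walkSupport C ∧ G.windingNumber C p = 0}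

/-- The circuit `C` delimits its inside with orientation `ε`, where `ε = 1` means anticlockwise
and `ε = -1` clockwise: `C` turns exactly once, in the direction `ε`, around each point of its
inside, and the inside is nonempty. -/
def HasOrientation (C : List E) (ε : ℤ) : Prop :=
  (ε = 1 ∨ ε = -1) ∧ (G.inside C).Nonempty ∧
    ∀ p ∈ G.inside C, G.windingNumber C p = (ε : ℝ)

/-- The interface graph: the links strictly between the inner circuit `C₁` and the outer circuit
`C₂` (links of `C₁` and of `C₂` do not belong to it). -/
def interface (C₁ C₂ : List E) : Set E :=
  {e | G.openArc e ⊆ G.outside C₁ ∩ G.inside C₂}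

/-- An Eulerian circuit of the subgraph formed by the links in `S`. -/
def IsEulerianCircuit (S : Set E) (γ : List E) : Prop :=
  G.IsCircuit γ ∧ ∀ e, e ∈ γ ↔ e ∈ S

/-- `F` is a central face of the interface graph: a face of it that meets the inside of `C₁`.
(If `C₁` is a simple closed curve, there is exactly one.) -/
def IsCentralFace (C₁ C₂ : List E) (F : Set ℂ) : Prop :=
  G.IsFace (G.interface C₁ C₂) F ∧ (F ∩ G.inside C₁).Nonempty

end PlaneDigraph

/-! Write W₁, W₂ and W for the winding functions of the two circuits and of the interface graph. The
winding function of a weighted set of links drops, from left to right across a link, by the weight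
of that link. It is bounded and tends to zero at infinity, and off the finitely many corners these
properties determine it (`weightedWinding_eq_of_jump`): the difference of two candidates is the
imaginary part, up to a constant factor, of a function holomorphic off the corners, and Liouville's
theorem applies to its exponential.

The competitor comes from the colouring of the faces. Off the circuits, ε₂W₂ − ε₁W₁ is the indicator
of the region between them, by nesting. Every link has a + face on its left and a − face on its
right, so the product of this indicator with that of the + faces drops by 1 across exactly those
links that have the region on their left: the interface links, those of C₁ if C₁ is clockwise, those
of C₂ if C₂ is anticlockwise (`sub_eq_betweenWeight`). Hence the product equals W + (1 − ε₁)/2 · W₁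
+ (1 + ε₂)/2 · W₂ off the corners (`graphWindingNumber_between_eq`).

Inside C₁ the product vanishes while W₁ = ε₁ and W₂ = ε₂, which leaves W = −(ε₁ + ε₂)/2. As W is
constant on a face of the interface graph, this is its value on all of F. An Eulerian circuit has
the same sum of angles as the set of its links. -/

open Filter Topology Complex

/-! ### Liouville's theorem with finitely many exceptional points -/

/-- Liouville's theorem for a bounded function that is holomorphic off a finite set. -/
theorem eq_of_bounded_of_differentiableAt_off_finite {K : Set ℂ} (hK : K.Finite) :
    ∀ f : ℂ → ℂ, (∀ z ∉ K, DifferentiableAt ℂ f z) → (∃ C, ∀ z, ‖f z‖ ≤ C) →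
      ∀ z ∉ K, ∀ w ∉ K, f z = f w := by
  induction K, hK using Set.Finite.induction_on with
  | empty =>
    rintro f hd ⟨C, hC⟩ z - w -
    refine Differentiable.apply_eq_apply_of_bounded (fun z => hd z (by simp)) ?_ z w
    exact isBounded_iff_forall_norm_le.2 ⟨C, by rintro _ ⟨z, rfl⟩; exact hC z⟩
  | @insert a K ha hK ih =>
    rintro f hd ⟨C, hC⟩ z hz w hw
    -- Removable singularity: `F` extends `f` holomorphically across `a`, leaving the smaller
    -- exceptional set `K`.
    set F := Function.update f a (limUnder (𝓝[≠] a) f) with hF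
    have hne : ∀ z, z ≠ a → F z = f z := fun z hz => Function.update_of_ne hz _ _
    have hU : Kᶜ ∈ 𝓝 a := hK.isClosed.isOpen_compl.mem_nhds ha
    have hdF : DifferentiableOn ℂ F Kᶜ := by
      refine differentiableOn_update_limUnder_of_bddAbove hU (fun z hz => ?_)
        ⟨C, by rintro _ ⟨z, -, rfl⟩; exact hC z⟩
      exact (hd z (by simp only [Set.mem_insert_iff, not_or]; exact ⟨hz.2, hz.1⟩)
        ).differentiableWithinAt
    have := ih F (fun z hz => hdF.differentiableAt (hK.isClosed.isOpen_compl.mem_nhds hz))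
      ⟨max C ‖F a‖, fun z => by
        by_cases h : z = a
        · subst h; exact le_max_right _ _
        · rw [hne z h]; exact (hC z).trans (le_max_left _ _)⟩
      z (fun h => hz (Set.mem_insert_of_mem _ h)) w (fun h => hw (Set.mem_insert_of_mem _ h))
    rwa [hne z (fun h => hz (h ▸ Set.mem_insert _ _)),
      hne w (fun h => hw (h ▸ Set.mem_insert _ _))] at this

/-! ### Sides of a segment and the jump of the logarithm -/

/-- Positive to the left of the line from `a` to `b`, negative to its right. -/
noncomputable def sideOf (a b q : ℂ) : ℝ := ((q - a) * starRingEnd ℂ (b - a)).im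

theorem sideOf_lineMap (a b : ℂ) (t : ℝ) : sideOf a b (AffineMap.lineMap a b t) = 0 := by
  simp [sideOf, AffineMap.lineMap_apply]; ring

theorem sideOf_of_mem_segment {a b q : ℂ} (h : q ∈ segment ℝ a b) : sideOf a b q = 0 := by
  rw [segment_eq_image_lineMap] at h
  obtain ⟨t, -, rfl⟩ := h
  exact sideOf_lineMap a b t

theorem sideOf_add_mul_I {a b q : ℂ} (h : sideOf a b q = 0) (t : ℝ) :
    sideOf a b (q + t * I * (b - a)) = t * ‖b - a‖ ^ 2 := by
  rw [← normSq_eq_norm_sq]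
  simp [sideOf, normSq_apply] at *
  linear_combination h

theorem sideOf_combo (a b x y : ℂ) {s t : ℝ} (hst : s + t = 1) :
    sideOf a b (s • x + t • y) = s * sideOf a b x + t * sideOf a b y := by
  simp [sideOf]
  linear_combination (a.re * (a.im - b.im) + a.im * (b.re - a.re)) * hst

theorem convex_sideOf_pos (a b : ℂ) : Convex ℝ {q | 0 < sideOf a b q} := by
  intro x hx y hy s t hs ht hst
  simp only [Set.mem_ofPred_eq] at *
  rw [sideOf_combo a b x y hst]
  exact convex_Ioi (𝕜 := ℝ) (0 : ℝ) hx hy hs ht hst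

theorem convex_sideOf_neg (a b : ℂ) : Convex ℝ {q | sideOf a b q < 0} := by
  intro x hx y hy s t hs ht hst
  simp only [Set.mem_ofPred_eq] at *
  rw [sideOf_combo a b x y hst]
  exact convex_Iio (𝕜 := ℝ) (0 : ℝ) hx hy hs ht hst

/-- Near a point of an open segment, the line through the segment is the segment. -/
theorem eventually_mem_segment_of_sideOf_eq_zero {a b p : ℂ} (hab : a ≠ b)
    (hp : p ∈ openSegment ℝ a b) : ∀ᶠ q in 𝓝 p, sideOf a b q = 0 → q ∈ segment ℝ a b := by
  have hn : normSq (b - a) ≠ 0 := by simpa [sub_eq_zero] using hab.symm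
  -- The parameter of the orthogonal projection of `q` to the line; it lies in (0, 1) at `p`, hence
  -- also nearby.
  let τ : ℂ → ℝ := fun q => ((q - a) * starRingEnd ℂ (b - a)).re / normSq (b - a)
  have hτ : Continuous τ := by
    have : Continuous fun q => ((q - a) * starRingEnd ℂ (b - a)).re := by fun_prop
    exact this.div_const _
  have hτp : τ p ∈ Set.Ioo (0 : ℝ) 1 := by
    rw [openSegment_eq_image_lineMap] at hp
    obtain ⟨t, ht, rfl⟩ := hp
    convert ht
    simp only [τ]
    rw [div_eq_iff hn]
    simp [AffineMap.lineMap_apply, normSq_apply]; ring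
  filter_upwards [hτ.continuousAt.eventually (isOpen_Ioo.mem_nhds hτp)] with q hq h0
  rw [segment_eq_image_lineMap]
  refine ⟨τ q, ⟨hq.1.le, hq.2.le⟩, ?_⟩
  have key : (q - a) * starRingEnd ℂ (b - a) = (τ q : ℂ) * (normSq (b - a) : ℂ) := by
    apply Complex.ext
    · rw [← ofReal_mul, ofReal_re]; simp only [τ]; rw [div_mul_cancel₀ _ hn]
    · rw [← ofReal_mul, ofReal_im]; exact h0
  have hb : starRingEnd ℂ (b - a) ≠ 0 := by
    rw [Ne, map_eq_zero]; exact sub_ne_zero.2 hab.symm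
  rw [← mul_conj, ← mul_assoc] at key
  have := mul_right_cancel₀ hb key
  rw [AffineMap.lineMap_apply]
  simp only [vsub_eq_sub, vadd_eq_add, real_smul]
  rw [← this]; ring

theorem im_ratio (a b q : ℂ) :
    ((b - q) / (a - q)).im = sideOf a b q / normSq (a - q) := by
  simp [sideOf, div_im]
  ring

/-- If b − q = −r(a − q) with r ≥ 0, then q is the convex combination of a and b with weights r/(1 +
r) and 1/(1 + r). -/
theorem ratio_mem_slitPlane {a b q : ℂ} (h : q ∉ segment ℝ a b) :
    (b - q) / (a - q) ∈ slitPlane := by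
  by_contra hz
  simp only [mem_slitPlane_iff, not_or, not_lt, not_not] at hz
  have ha : a - q ≠ 0 := sub_ne_zero.2 fun h' => h (h' ▸ left_mem_segment ℝ a b)
  obtain ⟨r, hr0, hr⟩ : ∃ r : ℝ, 0 ≤ r ∧ (b - q) / (a - q) = -(r : ℂ) :=
    ⟨-((b - q) / (a - q)).re, by linarith [hz.1], by
      apply Complex.ext
      · simp
      · simp [hz.2]⟩
  rw [div_eq_iff ha] at hr
  refine h ⟨r / (1 + r), 1 / (1 + r), by positivity, by positivity, by field_simp; ring, ?_⟩
  have h1 : (1 + r : ℂ) ≠ 0 := by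
    rw [← ofReal_one, ← ofReal_add, Ne, ofReal_eq_zero]; positivity
  simp only [real_smul]
  push_cast
  field_simp
  linear_combination hr

theorem ratio_neg {a b p : ℂ} (hab : a ≠ b) (hp : p ∈ openSegment ℝ a b) :
    ∃ r : ℝ, 0 < r ∧ (b - p) / (a - p) = -(r : ℂ) := by
  rw [openSegment_eq_image_lineMap] at hp
  obtain ⟨t, ht, rfl⟩ := hp
  refine ⟨(1 - t) / t, div_pos (by linarith [ht.2]) ht.1, ?_⟩
  have ht0 : (t : ℂ) ≠ 0 := ofReal_ne_zero.2 ht.1.ne'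
  have : a - AffineMap.lineMap a b t = -t * (b - a) := by
    simp [AffineMap.lineMap_apply]
  rw [this, div_eq_iff (mul_ne_zero (neg_ne_zero.2 ht0) (sub_ne_zero.2 hab.symm))]
  simp [AffineMap.lineMap_apply]
  field_simp
  ring

/-- On the left half-plane log(−z) is holomorphic, so the right-hand side isolates the jump of the
principal branch. On the cut itself arg is π, the limit from above; hence values on a link are
limits from its left. -/
theorem log_eq_log_neg {z : ℂ} (hz : z.re < 0) :
    log z = log (-z) + Real.pi * I - (if z.im < 0 then 2 * Real.pi * I else 0) := by
  apply Complex.ext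
  · split_ifs <;> simp [log_re]
  · rcases lt_trichotomy z.im 0 with h | h | h
    · simp [log_im, h, arg_neg_eq_arg_add_pi_of_im_neg h]; ring
    · have hz' : z = ((z.re : ℝ) : ℂ) := Complex.ext (by simp) (by simp [h])
      have h1 : arg z = Real.pi := arg_eq_pi_iff.2 ⟨hz, h⟩
      have h2 : arg (-z) = 0 := arg_eq_zero_iff.2 ⟨by simp [hz.le], by simp [h]⟩
      simp [log_im, h, h1, h2]
    · simp [log_im, h.not_gt, arg_neg_eq_arg_sub_pi_of_im_pos h]

theorem differentiableAt_ratio {a b p : ℂ} (ha : a ≠ p) :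
    DifferentiableAt ℂ (fun q => (b - q) / (a - q)) p :=
  ((differentiableAt_const _).sub differentiableAt_id).div
    ((differentiableAt_const _).sub differentiableAt_id) (sub_ne_zero.2 ha)

theorem differentiableAt_log_ratio {a b p : ℂ} (h : p ∉ segment ℝ a b) :
    DifferentiableAt ℂ (fun q => log ((b - q) / (a - q))) p :=
  (differentiableAt_ratio (by rintro rfl; exact h (left_mem_segment ℝ a b))).clog (ratio_mem_slitPlane h)

open Classical in
/-- The logarithm jumps by `2πi` across the segment. -/
theorem exists_log_ratio_eq {a b p : ℂ} (hab : a ≠ b) (hp : p ∈ openSegment ℝ a b) :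
    ∃ Λ : ℂ → ℂ, DifferentiableAt ℂ Λ p ∧ ∀ᶠ q in 𝓝 p, log ((b - q) / (a - q)) =
      Λ q - (if sideOf a b q < 0 then 2 * Real.pi * I else 0) := by
  obtain ⟨r, hr, hrp⟩ := ratio_neg hab hp
  have hap : a ≠ p := by
    rintro rfl; simp at hrp; exact hr.ne' hrp
  have hd := differentiableAt_ratio (b := b) hap
  refine ⟨fun q => log (-((b - q) / (a - q))) + Real.pi * I,
    (hd.neg.clog ?_).add_const _, ?_⟩
  · simp [hrp, hr]
  · have h1 : ∀ᶠ q in 𝓝 p, ((b - q) / (a - q)).re < 0 :=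
      (continuous_re.continuousAt.comp hd.continuousAt).eventually
        (isOpen_Iio.mem_nhds (by simp [hrp, hr]))
    filter_upwards [h1, isOpen_ne.mem_nhds hap.symm] with q hq hqa
    rw [log_eq_log_neg hq]
    have : 0 < normSq (a - q) := normSq_pos.2 (sub_ne_zero.2 (Ne.symm hqa))
    simp [im_ratio, div_neg_iff, this, this.not_gt]

/-- Seen from far away, a segment subtends a vanishing angle. -/
theorem tendsto_ratio_cobounded (a b : ℂ) :
    Tendsto (fun q => (b - q) / (a - q)) (Bornology.cobounded ℂ) (𝓝 1) := by
  have h1 : Tendsto (fun q : ℂ => a - q) (Bornology.cobounded ℂ) (Bornology.cobounded ℂ) := by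
    exact tendsto_const_sub_cobounded a
  have h2 : Tendsto (fun q : ℂ => 1 + (b - a) * (a - q)⁻¹) (Bornology.cobounded ℂ)
      (𝓝 (1 + (b - a) * 0)) :=
    ((tendsto_inv₀_cobounded.comp h1).const_mul _).const_add _
  rw [mul_zero, add_zero] at h2
  refine h2.congr' ?_
  have : ∀ᶠ q in Bornology.cobounded ℂ, q ≠ a := by
    exact Bornology.isBounded_def.1 (Bornology.isBounded_singleton (x := a))
  filter_upwards [this] with q hq
  have := sub_ne_zero.2 (Ne.symm hq)
  field_simp; ring

/-! ### Incidence of points, segments and links -/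

namespace PlaneDigraph

variable {V E : Type*} (G : PlaneDigraph V E)

/-- The corners of the links, end points included. -/
def corners : Set ℂ := {z | ∃ e i, i ≤ G.len e ∧ z = G.pt e i}

theorem finite_corners [Finite E] : G.corners.Finite := by
  have : G.corners = ⋃ e, G.pt e '' Set.Iic (G.len e) := by
    ext z; simp [corners, eq_comm]
  rw [this]
  exact Set.finite_iUnion fun e => (Set.finite_Iic _).image _

theorem isClosed_arc (e : E) : IsClosed (G.arc e) := by
  have : G.arc e = ⋃ i ∈ Set.Iio (G.len e), segment ℝ (G.pt e i) (G.pt e (i + 1)) := by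
    ext z; simp [arc]
  rw [this]
  refine (Set.finite_Iio _).isClosed_biUnion fun i _ => ?_
  rw [segment_eq_image_lineMap]
  exact (isCompact_Icc.image AffineMap.lineMap_continuous).isClosed

theorem isClosed_support [Finite E] (S : Set E) : IsClosed (G.support S) :=
  S.toFinite.isClosed_biUnion fun e _ => G.isClosed_arc e

theorem pt_ne_pt_succ {e : E} {i : ℕ} (hi : i < G.len e) : G.pt e i ≠ G.pt e (i + 1) := by
  intro h
  have := G.inner_injective e e i i (1 / 2) (1 / 3) hi (by norm_num) (by positivity) hi
    (by norm_num) (by positivity) (by simp [h])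
  norm_num at this

/-- A point of a link other than its end points lies on no other link, and on no other segment
of the same link unless it is a corner. -/
theorem eq_of_lineMap_mem_segment {e e' : E} {i i' : ℕ} {t : ℝ} (hi : i < G.len e)
    (ht : t ∈ Set.Ico (0 : ℝ) 1) (h0 : 0 < (i : ℝ) + t) (hi' : i' < G.len e')
    (hp : AffineMap.lineMap (G.pt e i) (G.pt e (i + 1)) t ∈
      segment ℝ (G.pt e' i') (G.pt e' (i' + 1))) : e = e' ∧ (t ≠ 0 → i = i') := by
  rw [segment_eq_image_lineMap] at hp
  obtain ⟨t', ht', h⟩ := hp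
  have hv := fun v => G.inner_ne_vertex e i t v hi ht h0
  -- Injectivity covers only parameters in [0, 1). Parameter 1 is the start of the next segment or
  -- the target vertex.
  rcases ht'.2.eq_or_lt with rfl | h1
  · rw [AffineMap.lineMap_apply_one] at h
    rcases (Nat.succ_le_of_lt hi').eq_or_lt with h2 | h2
    · exact absurd (by rw [← h, ← G.pt_len, ← h2]) (hv (G.tgt e'))
    · obtain ⟨he, -, h3⟩ := G.inner_injective e e' i (i' + 1) t 0 hi ht h0 h2 (by norm_num)
        (by push_cast; positivity) (by rw [AffineMap.lineMap_apply_zero, h])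
      exact ⟨he, fun h => absurd h3 h⟩
  · by_cases h2 : 0 < (i' : ℝ) + t'
    · obtain ⟨h3, h4, -⟩ := G.inner_injective e e' i i' t t' hi ht h0 hi' ⟨ht'.1, h1⟩ h2 h.symm
      exact ⟨h3, fun _ => h4⟩
    · have h3 : (i' : ℝ) = 0 := by linarith [ht'.1, (Nat.cast_nonneg i' : (0 : ℝ) ≤ i')]
      have h4 : t' = 0 := by linarith [ht'.1, (Nat.cast_nonneg i' : (0 : ℝ) ≤ i')]
      rw [Nat.cast_eq_zero] at h3
      subst h3 h4
      rw [AffineMap.lineMap_apply_zero, G.pt_zero] at h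
      exact absurd h.symm (hv _)

/-- An open segment of a link meets no other segment of a link. -/
theorem eq_of_mem_openSegment_of_mem_segment {p : ℂ} {e e' : E} {i i' : ℕ} (hi : i < G.len e)
    (hp : p ∈ openSegment ℝ (G.pt e i) (G.pt e (i + 1))) (hi' : i' < G.len e')
    (hp' : p ∈ segment ℝ (G.pt e' i') (G.pt e' (i' + 1))) : e = e' ∧ i = i' := by
  rw [openSegment_eq_image_lineMap] at hp
  obtain ⟨t, ht, rfl⟩ := hp
  obtain ⟨h1, h2⟩ := G.eq_of_lineMap_mem_segment hi ⟨ht.1.le, ht.2⟩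
    (add_pos_of_nonneg_of_pos (Nat.cast_nonneg _) ht.1) hi' hp'
  exact ⟨h1, h2 ht.1.ne'⟩

theorem notMem_arc_of_ne {p : ℂ} {e e' : E} {i : ℕ} (hi : i < G.len e)
    (hp : p ∈ openSegment ℝ (G.pt e i) (G.pt e (i + 1))) (h : e' ≠ e) : p ∉ G.arc e' := by
  rintro ⟨i', hi', hp'⟩
  exact h (G.eq_of_mem_openSegment_of_mem_segment hi hp hi' hp').1.symm

theorem notMem_support {p : ℂ} {e : E} {i : ℕ} (hi : i < G.len e)
    (hp : p ∈ openSegment ℝ (G.pt e i) (G.pt e (i + 1))) {S : Set E} (h : e ∉ S) :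
    p ∉ G.support S := by
  simp only [support, Set.mem_iUnion, not_exists]
  exact fun e' he' => G.notMem_arc_of_ne hi hp (fun h' => h (h' ▸ he'))

theorem mem_support {p : ℂ} {e : E} {i : ℕ} (hi : i < G.len e)
    (hp : p ∈ openSegment ℝ (G.pt e i) (G.pt e (i + 1))) {S : Set E} (h : e ∈ S) :
    p ∈ G.support S :=
  Set.mem_biUnion h ⟨i, hi, openSegment_subset_segment _ _ _ hp⟩

theorem mem_openArc {p : ℂ} {e : E} {i : ℕ} (hi : i < G.len e)
    (hp : p ∈ openSegment ℝ (G.pt e i) (G.pt e (i + 1))) : p ∈ G.openArc e := by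
  rw [openSegment_eq_image_lineMap] at hp
  obtain ⟨t, ht, rfl⟩ := hp
  exact ⟨i, t, hi, ⟨ht.1.le, ht.2⟩, add_pos_of_nonneg_of_pos (Nat.cast_nonneg _) ht.1, rfl⟩

theorem exists_mem_openSegment {p : ℂ} (hp : p ∉ G.corners) {S : Set E}
    (h : p ∈ G.support S) :
    ∃ e ∈ S, ∃ i, i < G.len e ∧ p ∈ openSegment ℝ (G.pt e i) (G.pt e (i + 1)) := by
  obtain ⟨e, he, i, hi, hpi⟩ := Set.mem_iUnion₂.1 h
  refine ⟨e, he, i, hi, mem_openSegment_of_ne_left_right ?_ ?_ hpi⟩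
  · rintro rfl; exact hp ⟨e, i, hi.le, rfl⟩
  · rintro rfl; exact hp ⟨e, i + 1, hi, rfl⟩

theorem notMem_corners {p : ℂ} {e : E} {i : ℕ} (hi : i < G.len e)
    (hp : p ∈ openSegment ℝ (G.pt e i) (G.pt e (i + 1))) : p ∉ G.corners := by
  rintro ⟨e', i', hi', rfl⟩
  rcases hi'.lt_or_eq with h | h
  · obtain ⟨rfl, rfl⟩ := G.eq_of_mem_openSegment_of_mem_segment hi hp h (left_mem_segment ℝ _ _)
    exact G.pt_ne_pt_succ hi (left_mem_openSegment_iff.1 hp)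
  · obtain ⟨k, rfl⟩ : ∃ k, i' = k + 1 := ⟨i' - 1, by have := G.len_pos e'; omega⟩
    obtain ⟨rfl, rfl⟩ := G.eq_of_mem_openSegment_of_mem_segment hi hp (i' := k) (by omega)
      (right_mem_segment ℝ _ _)
    exact G.pt_ne_pt_succ hi (right_mem_openSegment_iff.1 hp)

theorem notMem_arc_of_mem_openArc {p : ℂ} {e e' : E} (hp : p ∈ G.openArc e) (h : e ≠ e') :
    p ∉ G.arc e' := by
  obtain ⟨i, t, hi, ht, h0, rfl⟩ := hp
  rintro ⟨i', hi', hp'⟩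
  exact h (G.eq_of_lineMap_mem_segment hi ht h0 hi' hp').1

theorem isPreconnected_openArc (e : E) : IsPreconnected (G.openArc e) := by
  -- Parameters of the `i`-th segment, with the end points of the link removed but the corners
  -- shared by consecutive segments kept, so that the pieces form a chain.
  let J : ℕ → Set ℝ := fun i => Set.Icc 0 1 ∩ {t | 0 < (i : ℝ) + t ∧ (i : ℝ) + t < G.len e}
  have hJ : ∀ i, (J i).OrdConnected := fun i =>
    Set.ordConnected_Icc.inter ⟨fun x hx y hy z hz =>
      ⟨hx.1.trans_le (by gcongr; exact hz.1), lt_of_le_of_lt (by gcongr; exact hz.2) hy.2⟩⟩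
  have key : G.openArc e = ⋃ i ∈ Set.Iio (G.len e),
      AffineMap.lineMap (G.pt e i) (G.pt e (i + 1)) '' J i := by
    ext z
    simp only [Set.mem_iUnion, Set.mem_Iio, exists_prop]
    constructor
    · rintro ⟨i, t, hi, ht, h0, rfl⟩
      refine ⟨i, hi, t, ⟨⟨ht.1, ht.2.le⟩, h0, ?_⟩, rfl⟩
      have : ((i + 1 : ℕ) : ℝ) ≤ G.len e := Nat.cast_le.2 hi
      push_cast at this
      linarith [ht.2]
    · rintro ⟨i, hi, t, ⟨ht, h0, h1⟩, rfl⟩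
      rcases ht.2.eq_or_lt with rfl | h
      · exact ⟨i + 1, 0, by exact_mod_cast h1, by norm_num, by push_cast; positivity, by simp⟩
      · exact ⟨i, t, hi, ⟨ht.1, h⟩, h0, rfl⟩
  rw [key]
  refine IsPreconnected.biUnion_of_chain Set.ordConnected_Iio
    (fun i _ => (hJ i).isPreconnected.image _ AffineMap.lineMap_continuous.continuousOn)
    fun i _ hi => ⟨G.pt e (i + 1), ⟨1, ⟨by norm_num, by positivity, ?_⟩, by simp⟩,
      ⟨0, ⟨by norm_num, ?_, ?_⟩, by simp⟩⟩
  · exact_mod_cast hi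
  · simp only [Nat.succ_eq_succ, Nat.succ_eq_add_one]; positivity
  · rw [add_zero]; exact_mod_cast hi

/-! ### Variation of the argument along a link -/

/-- The holomorphic counterpart of `linkAngle`. -/
noncomputable def linkLog (p : ℂ) (e : E) : ℂ :=
  ∑ i ∈ Finset.range (G.len e), log ((G.pt e (i + 1) - p) / (G.pt e i - p))

theorem linkLog_im (p : ℂ) (e : E) : (G.linkLog p e).im = G.linkAngle p e := by
  simp [linkLog, linkAngle, log_im]

theorem differentiableAt_linkLog {p : ℂ} {e : E} (h : p ∉ G.arc e) :
    DifferentiableAt ℂ (fun q => G.linkLog q e) p := by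
  unfold linkLog
  exact DifferentiableAt.fun_sum fun i hi =>
    differentiableAt_log_ratio fun hp => h ⟨i, Finset.mem_range.1 hi, hp⟩

open Classical in
theorem exists_linkLog_eq {p : ℂ} {e : E} {i : ℕ} (hi : i < G.len e)
    (hp : p ∈ openSegment ℝ (G.pt e i) (G.pt e (i + 1))) :
    ∃ Λ : ℂ → ℂ, DifferentiableAt ℂ Λ p ∧ ∀ᶠ q in 𝓝 p, G.linkLog q e =
      Λ q - (if sideOf (G.pt e i) (G.pt e (i + 1)) q < 0 then 2 * Real.pi * I else 0) := by
  obtain ⟨Λ, hΛ, h⟩ := exists_log_ratio_eq (G.pt_ne_pt_succ hi) hp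
  refine ⟨fun q => Λ q + ∑ k ∈ (Finset.range (G.len e)).erase i,
    log ((G.pt e (k + 1) - q) / (G.pt e k - q)),
    hΛ.add (DifferentiableAt.fun_sum fun k hk => differentiableAt_log_ratio fun hpk => ?_), ?_⟩
  · rw [Finset.mem_erase, Finset.mem_range] at hk
    exact hk.1 (G.eq_of_mem_openSegment_of_mem_segment hi hp hk.2 hpk).2.symm
  · filter_upwards [h] with q hq
    rw [linkLog, ← Finset.add_sum_erase _ _ (Finset.mem_range.2 hi), hq]
    ring

theorem abs_linkAngle_le (p : ℂ) (e : E) : |G.linkAngle p e| ≤ G.len e * Real.pi := by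
  refine (Finset.abs_sum_le_sum_abs _ _).trans
    ((Finset.sum_le_sum fun i _ => abs_arg_le_pi _).trans ?_)
  simp

theorem tendsto_linkAngle (e : E) :
    Tendsto (fun p => G.linkAngle p e) (Bornology.cobounded ℂ) (𝓝 0) := by
  unfold linkAngle
  have : (0 : ℝ) = ∑ i ∈ Finset.range (G.len e), arg 1 := by simp
  rw [this]
  refine tendsto_finsetSum _ fun i _ => ?_
  exact (continuousAt_arg one_mem_slitPlane).tendsto.comp (tendsto_ratio_cobounded _ _)

/-! ### Weighted winding numbers, determined by their jumps -/

section Weighted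

variable [Fintype E]

/-- The winding number of the links of `G` counted with weights. -/
noncomputable def weightedWinding (c : E → ℝ) (p : ℂ) : ℝ :=
  (∑ e, c e * G.linkAngle p e) / (2 * Real.pi)

/-- The holomorphic counterpart of `weightedWinding`, up to the factor `2π`. -/
noncomputable def weightedLog (c : E → ℝ) (p : ℂ) : ℂ := ∑ e, (c e : ℂ) * G.linkLog p e

theorem weightedLog_im (c : E → ℝ) (p : ℂ) :
    (G.weightedLog c p).im = 2 * Real.pi * G.weightedWinding c p := by
  simp only [weightedLog, weightedWinding, im_sum, im_ofReal_mul, linkLog_im]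
  field_simp

theorem weightedWinding_eq (c : E → ℝ) (p : ℂ) :
    G.weightedWinding c p = (G.weightedLog c p).im / (2 * Real.pi) := by
  rw [weightedLog_im]; field_simp

theorem differentiableAt_weightedLog {c : E → ℝ} {S : Set E} (hS : ∀ e ∉ S, c e = 0) {p : ℂ}
    (hp : p ∉ G.support S) : DifferentiableAt ℂ (G.weightedLog c) p := by
  unfold weightedLog
  refine DifferentiableAt.fun_sum fun e _ => ?_
  by_cases he : e ∈ S
  · exact (G.differentiableAt_linkLog fun h => hp (Set.mem_biUnion he h)).const_mul _
  · simp [hS e he]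

theorem continuousAt_weightedWinding {c : E → ℝ} {S : Set E} (hS : ∀ e ∉ S, c e = 0) {p : ℂ}
    (hp : p ∉ G.support S) : ContinuousAt (G.weightedWinding c) p := by
  have : G.weightedWinding c = fun p => (G.weightedLog c p).im / (2 * Real.pi) :=
    funext (G.weightedWinding_eq c)
  rw [this]
  exact (continuous_im.continuousAt.comp
    (G.differentiableAt_weightedLog hS hp).continuousAt).div_const _

open Classical in
theorem exists_weightedLog_eq (c : E → ℝ) {p : ℂ} {e : E} {i : ℕ} (hi : i < G.len e)
    (hp : p ∈ openSegment ℝ (G.pt e i) (G.pt e (i + 1))) :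
    ∃ Λ : ℂ → ℂ, DifferentiableAt ℂ Λ p ∧ ∀ᶠ q in 𝓝 p, G.weightedLog c q =
      Λ q - 2 * Real.pi * I *
        ((if sideOf (G.pt e i) (G.pt e (i + 1)) q < 0 then c e else 0 : ℝ) : ℂ) := by
  obtain ⟨Λ, hΛ, h⟩ := G.exists_linkLog_eq hi hp
  refine ⟨fun q => c e * Λ q + ∑ f ∈ Finset.univ.erase e, (c f : ℂ) * G.linkLog q f,
    (hΛ.const_mul _).add (DifferentiableAt.fun_sum fun f hf =>
      (G.differentiableAt_linkLog (G.notMem_arc_of_ne hi hp (Finset.ne_of_mem_erase hf))).const_mul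
        _), ?_⟩
  filter_upwards [h] with q hq
  rw [weightedLog, ← Finset.add_sum_erase _ _ (Finset.mem_univ e), hq]
  split_ifs <;> push_cast <;> ring

open Classical in
theorem exists_weightedWinding_eq (c : E → ℝ) {p : ℂ} {e : E} {i : ℕ} (hi : i < G.len e)
    (hp : p ∈ openSegment ℝ (G.pt e i) (G.pt e (i + 1))) :
    ∃ κ : ℂ → ℝ, ContinuousAt κ p ∧ ∀ᶠ q in 𝓝 p, G.weightedWinding c q =
      κ q - (if sideOf (G.pt e i) (G.pt e (i + 1)) q < 0 then c e else 0) := by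
  obtain ⟨Λ, hΛ, h⟩ := G.exists_weightedLog_eq c hi hp
  refine ⟨fun q => (Λ q).im / (2 * Real.pi),
    (continuous_im.continuousAt.comp hΛ.continuousAt).div_const _, ?_⟩
  filter_upwards [h] with q hq
  rw [weightedWinding_eq, hq, sub_im, im_mul_ofReal]
  have : (2 * Real.pi * I : ℂ).im = 2 * Real.pi := by simp
  rw [this]
  field_simp

theorem exists_abs_weightedWinding_le (c : E → ℝ) : ∃ C, ∀ p, |G.weightedWinding c p| ≤ C := by
  refine ⟨(∑ e, |c e| * (G.len e * Real.pi)) / (2 * Real.pi), fun p => ?_⟩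
  rw [weightedWinding, abs_div, abs_of_pos Real.two_pi_pos]
  gcongr
  refine (Finset.abs_sum_le_sum_abs _ _).trans (Finset.sum_le_sum fun e _ => ?_)
  rw [abs_mul]
  gcongr
  exact G.abs_linkAngle_le p e

theorem tendsto_weightedWinding (c : E → ℝ) :
    Tendsto (G.weightedWinding c) (Bornology.cobounded ℂ) (𝓝 0) := by
  have : Tendsto (fun p => (∑ e, c e * G.linkAngle p e) / (2 * Real.pi)) (Bornology.cobounded ℂ)
      (𝓝 ((∑ e : E, c e * 0) / (2 * Real.pi))) :=
    (tendsto_finsetSum _ fun e _ => (G.tendsto_linkAngle e).const_mul _).div_const _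
  simp only [mul_zero, Finset.sum_const_zero, zero_div] at this
  exact this

open Classical in
/-- A bounded function that vanishes at infinity and has the same jumps across the links as the
weighted winding number agrees with it off the corners. -/
theorem weightedWinding_eq_of_jump (c : E → ℝ) (g : ℂ → ℝ)
    (hbdd : ∃ C, ∀ p, |g p| ≤ C) (hlim : Tendsto g (Bornology.cobounded ℂ) (𝓝 0))
    (hoff : ∀ p ∉ G.support Set.univ, ∀ᶠ q in 𝓝 p, g q = g p)
    (hjump : ∀ e i, i < G.len e → ∀ p ∈ openSegment ℝ (G.pt e i) (G.pt e (i + 1)),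
      ∀ᶠ q in 𝓝 p, g q = g p - if sideOf (G.pt e i) (G.pt e (i + 1)) q < 0 then c e else 0)
    {p : ℂ} (hp : p ∉ G.corners) : G.weightedWinding c p = g p := by
  let L : ℂ → ℂ := fun q => G.weightedLog c q - 2 * Real.pi * I * (g q : ℂ)
  have hLim : ∀ q, (L q).im = 2 * Real.pi * (G.weightedWinding c q - g q) := by
    intro q
    have : (2 * Real.pi * I : ℂ).im = 2 * Real.pi := by simp
    simp only [L, sub_im, weightedLog_im, im_mul_ofReal, this]
    ring
  have hL : ∀ z ∉ G.corners, DifferentiableAt ℂ L z := by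
    intro z hz
    by_cases hs : z ∈ G.support Set.univ
    · obtain ⟨e, -, i, hi, hzi⟩ := G.exists_mem_openSegment hz hs
      obtain ⟨Λ, hΛ, h⟩ := G.exists_weightedLog_eq c hi hzi
      refine (hΛ.sub_const (2 * Real.pi * I * (g z : ℂ))).congr_of_eventuallyEq ?_
      filter_upwards [h, hjump e i hi z hzi] with q h1 h2
      simp only [L, h1, h2]
      push_cast
      ring
    · refine ((G.differentiableAt_weightedLog (c := c) (S := Set.univ) (by simp) hs).sub_const
        (2 * Real.pi * I * (g z : ℂ))).congr_of_eventuallyEq ?_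
      filter_upwards [hoff z hs] with q hq
      simp only [L, hq]
  obtain ⟨C, hC⟩ := hbdd
  obtain ⟨D, hD⟩ := G.exists_abs_weightedWinding_le c
  -- Only the imaginary part of `L` is known to be bounded. The modulus of exp(iL) depends on
  -- nothing else, so Liouville applies to it and makes Im `L` constant off the corners.
  have hconst := eq_of_bounded_of_differentiableAt_off_finite G.finite_corners
    (fun z => exp (I * L z)) (fun z hz => ((hL z hz).const_mul I).cexp)
    ⟨Real.exp (2 * Real.pi * (D + C)), fun z => by
      rw [norm_exp, Real.exp_le_exp]
      simp only [I_mul_re, hLim]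
      have := abs_le.1 (hC z)
      have := abs_le.1 (hD z)
      rw [← mul_neg]
      gcongr
      linarith⟩
  have hev : ∀ᶠ q in Bornology.cobounded ℂ,
      G.weightedWinding c p - g p = G.weightedWinding c q - g q := by
    have : ∀ᶠ q in Bornology.cobounded ℂ, q ∉ G.corners :=
      Bornology.isBounded_def.1 G.finite_corners.isBounded
    filter_upwards [this] with q hq
    have := congrArg norm (hconst p hp q hq)
    rw [norm_exp, norm_exp, Real.exp_eq_exp, I_mul_re, I_mul_re, hLim, hLim, neg_inj] at this
    exact mul_left_cancel₀ Real.two_pi_pos.ne' this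
  have h1 := (G.tendsto_weightedWinding c).sub hlim
  rw [sub_zero] at h1
  exact sub_eq_zero.1 (tendsto_nhds_unique (tendsto_const_nhds.congr' hev) h1)

end Weighted

end PlaneDigraph

/-! ### Local constancy, and approach to a segment from either side -/

theorem eventually_eq_of_eventually_int {X : Type*} [TopologicalSpace X] {f : X → ℝ} {p : X}
    (hf : ContinuousAt f p) (h : ∀ᶠ q in 𝓝 p, ∃ n : ℤ, f q = n) : ∀ᶠ q in 𝓝 p, f q = f p := by
  obtain ⟨m, hm⟩ := h.self_of_nhds
  filter_upwards [h, hf.eventually (Metric.ball_mem_nhds (f p) one_pos)] with q ⟨n, hn⟩ hq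
  change dist (f q) (f p) < 1 at hq
  rw [Real.dist_eq, hn, hm] at hq
  rw [hn, hm]
  have : |n - m| < 1 := by exact_mod_cast hq
  rw [Int.abs_lt_one_iff] at this
  rw [sub_eq_zero.1 this]

theorem frequently_sideOf_pos {a b p : ℂ} (hab : a ≠ b) (hp : sideOf a b p = 0) :
    ∃ᶠ q in 𝓝 p, 0 < sideOf a b q := by
  have ht : Tendsto (fun t : ℝ => p + t * I * (b - a)) (𝓝[>] 0) (𝓝 p) := by
    have : Continuous fun t : ℝ => p + t * I * (b - a) := by fun_prop
    simpa using (this.tendsto 0).mono_left nhdsWithin_le_nhds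
  refine ht.frequently (Eventually.frequently ?_)
  filter_upwards [self_mem_nhdsWithin] with t (ht : 0 < t)
  rw [sideOf_add_mul_I hp]
  have : 0 < ‖b - a‖ := norm_pos_iff.2 (sub_ne_zero.2 hab.symm)
  positivity

theorem frequently_sideOf_neg {a b p : ℂ} (hab : a ≠ b) (hp : sideOf a b p = 0) :
    ∃ᶠ q in 𝓝 p, sideOf a b q < 0 := by
  have ht : Tendsto (fun t : ℝ => p + (-t : ℝ) * I * (b - a)) (𝓝[>] 0) (𝓝 p) := by
    have : Continuous fun t : ℝ => p + (-t : ℝ) * I * (b - a) := by fun_prop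
    simpa using (this.tendsto 0).mono_left nhdsWithin_le_nhds
  refine ht.frequently (Eventually.frequently ?_)
  filter_upwards [self_mem_nhdsWithin] with t (ht : 0 < t)
  rw [sideOf_add_mul_I hp]
  have : 0 < ‖b - a‖ := norm_pos_iff.2 (sub_ne_zero.2 hab.symm)
  have : 0 < t * ‖b - a‖ ^ 2 := by positivity
  linarith

namespace PlaneDigraph

variable {V E : Type*} (G : PlaneDigraph V E)

/-! ### The indicator of the positive faces -/

section Sides

open Classical in
/-- Equals `1` on the graph and on the faces that touch a link from its left. -/
noncomputable def leftIndicator (q : ℂ) : ℝ :=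
  if q ∈ G.support Set.univ ∨
    ∃ e, G.LiesLeft (connectedComponentIn (G.support Set.univ)ᶜ q) e then 1 else 0

theorem abs_leftIndicator_le (q : ℂ) : |G.leftIndicator q| ≤ 1 := by
  unfold leftIndicator; split_ifs <;> simp

variable [Finite E]

/-- Near a point of an open segment, all points of the graph belong to that segment. -/
theorem eventually_mem_support_imp {p : ℂ} {e : E} {i : ℕ} (hi : i < G.len e)
    (hp : p ∈ openSegment ℝ (G.pt e i) (G.pt e (i + 1))) :
    ∀ᶠ q in 𝓝 p, q ∈ G.support Set.univ → q ∈ segment ℝ (G.pt e i) (G.pt e (i + 1)) := by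
  have : ∀ᶠ q in 𝓝 p, ∀ e', ∀ i' ∈ Set.Iio (G.len e'),
      q ∈ segment ℝ (G.pt e' i') (G.pt e' (i' + 1)) → e = e' ∧ i = i' := by
    refine eventually_all.2 fun e' => (eventually_all_finite (Set.finite_Iio _)).2 fun i' hi' => ?_
    by_cases h : e = e' ∧ i = i'
    · exact Eventually.of_forall fun q _ => h
    · have hc : IsClosed (segment ℝ (G.pt e' i') (G.pt e' (i' + 1))) := by
        rw [segment_eq_image_lineMap]
        exact (isCompact_Icc.image AffineMap.lineMap_continuous).isClosed
      filter_upwards [hc.isOpen_compl.mem_nhds fun hp' =>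
        h (G.eq_of_mem_openSegment_of_mem_segment hi hp hi' hp')] with q hq hq'
      exact absurd hq' hq
  filter_upwards [this] with q hq hs
  obtain ⟨e', -, i', hi', hq'⟩ := Set.mem_iUnion₂.1 hs
  obtain ⟨rfl, rfl⟩ := hq e' i' hi' hq'
  exact hq'

theorem eventually_leftIndicator_eq {p : ℂ} (hp : p ∉ G.support Set.univ) :
    ∀ᶠ q in 𝓝 p, G.leftIndicator q = G.leftIndicator p := by
  have ho := (G.isClosed_support Set.univ).isOpen_compl
  filter_upwards [ho.connectedComponentIn.mem_nhds (mem_connectedComponentIn hp)] with q hq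
  have hq' : q ∉ G.support Set.univ := connectedComponentIn_subset _ _ hq
  classical
  unfold leftIndicator
  rw [connectedComponentIn_eq hq]
  exact if_congr (or_congr_left (iff_of_false hq' hp)) rfl rfl

-- A small disc about `p` meets the graph only in the segment, and each open half-disc is convex,
-- hence lies in one face. The left one touches `e` from the left; the right one touches it from the
-- right, so by the colouring it touches no link from the left. The value 1 on the graph is again
-- the limit from the left.
open Classical in
theorem eventually_leftIndicator_eq_ite (hface : G.FacesOriented) {p : ℂ} {e : E} {i : ℕ}
    (hi : i < G.len e) (hp : p ∈ openSegment ℝ (G.pt e i) (G.pt e (i + 1))) :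
    ∀ᶠ q in 𝓝 p, G.leftIndicator q =
      1 - if sideOf (G.pt e i) (G.pt e (i + 1)) q < 0 then 1 else 0 := by
  set a := G.pt e i with ha
  set b := G.pt e (i + 1) with hb
  have hab : a ≠ b := G.pt_ne_pt_succ hi
  have hp0 : sideOf a b p = 0 := sideOf_of_mem_segment (openSegment_subset_segment _ _ _ hp)
  obtain ⟨r, hr, h⟩ := Metric.eventually_nhds_iff_ball.1 ((G.eventually_mem_support_imp hi hp).and
    (eventually_mem_segment_of_sideOf_eq_zero hab hp))
  have hnorm : 0 < ‖b - a‖ := norm_pos_iff.2 (sub_ne_zero.2 hab.symm)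
  have hball : ∀ t : ℝ, |t| < r / ‖b - a‖ → p + t * I * (b - a) ∈ Metric.ball p r := by
    intro t ht
    rw [lt_div_iff₀ hnorm] at ht
    simpa [dist_eq_norm] using ht
  have hoff : ∀ q ∈ Metric.ball p r, sideOf a b q ≠ 0 → q ∉ G.support Set.univ :=
    fun q hq hq0 hs => hq0 (sideOf_of_mem_segment ((h q hq).1 hs))
  filter_upwards [Metric.ball_mem_nhds p hr] with q hq
  rcases lt_trichotomy (sideOf a b q) 0 with h0 | h0 | h0
  · have hqs := hoff q hq h0.ne
    have hsub : Metric.ball p r ∩ {z | sideOf a b z < 0} ⊆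
        connectedComponentIn (G.support Set.univ)ᶜ q :=
      ((convex_ball p r).inter (convex_sideOf_neg a b)).isPreconnected.subset_connectedComponentIn
        ⟨hq, h0⟩ fun z hz => hoff z hz.1 (ne_of_lt hz.2)
    have hR : G.LiesRight (connectedComponentIn (G.support Set.univ)ᶜ q) e := by
      refine ⟨i, hi, p, hp, r / ‖b - a‖, by positivity, fun t ht ht' => hsub ?_⟩
      have e1 : p - t * I * (b - a) = p + (-t : ℝ) * I * (b - a) := by push_cast; ring
      rw [← ha, ← hb, e1]
      refine ⟨hball _ (by rwa [abs_neg, abs_of_pos ht]), ?_⟩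
      rw [Set.mem_ofPred_eq, sideOf_add_mul_I hp0]
      have : 0 < t * ‖b - a‖ ^ 2 := by positivity
      linarith
    have hL := (hface _ ⟨q, hqs, rfl⟩).resolve_left fun h => h e hR
    simp [leftIndicator, hqs, hL, h0]
  · have : q ∈ G.support Set.univ := Set.mem_biUnion (Set.mem_univ e) ⟨i, hi, (h q hq).2 h0⟩
    simp [leftIndicator, this, h0]
  · have hsub : Metric.ball p r ∩ {z | 0 < sideOf a b z} ⊆
        connectedComponentIn (G.support Set.univ)ᶜ q :=
      ((convex_ball p r).inter (convex_sideOf_pos a b)).isPreconnected.subset_connectedComponentIn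
        ⟨hq, h0⟩ fun z hz => hoff z hz.1 (ne_of_gt hz.2)
    have hL : G.LiesLeft (connectedComponentIn (G.support Set.univ)ᶜ q) e := by
      refine ⟨i, hi, p, hp, r / ‖b - a‖, by positivity, fun t ht ht' => hsub ?_⟩
      refine ⟨hball _ (by rwa [abs_of_pos ht]), ?_⟩
      rw [Set.mem_ofPred_eq, sideOf_add_mul_I hp0]
      positivity
    have : G.leftIndicator q = 1 := if_pos (Or.inr ⟨e, hL⟩)
    simp [this, h0.not_gt]

end Sides

/-! ### Winding numbers of circuits with an orientation -/

section Winding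

variable [Fintype E]

theorem graphWindingNumber_eq (S : Set E) (p : ℂ) :
    G.graphWindingNumber S p = G.weightedWinding (S.indicator 1) p := by
  classical
  unfold graphWindingNumber weightedWinding
  congr 1
  refine Finset.sum_congr rfl fun e _ => ?_
  by_cases he : e ∈ S <;> simp [he]

theorem windingNumber_eq {γ : List E} (hγ : γ.Nodup) (p : ℂ) :
    G.windingNumber γ p = G.graphWindingNumber {e | e ∈ γ} p := by
  classical
  rw [windingNumber, graphWindingNumber, ← List.sum_toFinset _ hγ]
  congr 1
  exact (Finset.sum_congr rfl fun e he => (if_pos (List.mem_toFinset.1 he)).symm).trans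
    (Finset.sum_subset (Finset.subset_univ _) fun e _ he => if_neg fun h =>
      he (List.mem_toFinset.2 h))

theorem continuousAt_graphWindingNumber {S : Set E} {p : ℂ} (hp : p ∉ G.support S) :
    ContinuousAt (G.graphWindingNumber S) p := by
  have : G.graphWindingNumber S = G.weightedWinding (S.indicator 1) :=
    funext (G.graphWindingNumber_eq S)
  rw [this]
  exact G.continuousAt_weightedWinding (fun e he => Set.indicator_of_notMem he _) hp

/-- The links of `S` turn `ε` times or not at all around each point off `S`, where `ε` is a sign. -/
def Delimits (S : Set E) (ε : ℤ) : Prop :=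
  (ε = 1 ∨ ε = -1) ∧
    ∀ p ∉ G.support S, G.graphWindingNumber S p = 0 ∨ G.graphWindingNumber S p = ε

variable {G} {S : Set E} {ε : ℤ}

theorem Delimits.eventually_eq_of_notMem (h : G.Delimits S ε) {p : ℂ} (hp : p ∉ G.support S) :
    ∀ᶠ q in 𝓝 p, G.graphWindingNumber S q = G.graphWindingNumber S p := by
  refine eventually_eq_of_eventually_int (G.continuousAt_graphWindingNumber hp) ?_
  filter_upwards [(G.isClosed_support S).isOpen_compl.mem_nhds hp] with q hq
  rcases h.2 q hq with h | h
  · exact ⟨0, by simp [h]⟩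
  · exact ⟨ε, h⟩

open Classical in
theorem exists_graphWindingNumber_eq {p : ℂ} {e : E} {i : ℕ} (hi : i < G.len e)
    (hp : p ∈ openSegment ℝ (G.pt e i) (G.pt e (i + 1))) (he : e ∈ S) :
    ∃ κ : ℂ → ℝ, ContinuousAt κ p ∧ ∀ᶠ q in 𝓝 p, G.graphWindingNumber S q =
      κ q - (if sideOf (G.pt e i) (G.pt e (i + 1)) q < 0 then 1 else 0) := by
  simpa [graphWindingNumber_eq, he] using G.exists_weightedWinding_eq (S.indicator 1) hi hp

/-- On an open segment, winding numbers take their limits from the left. -/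
theorem Delimits.eq_or_eq (h : G.Delimits S ε) {p : ℂ} (hp : p ∉ G.corners) :
    G.graphWindingNumber S p = 0 ∨ G.graphWindingNumber S p = ε := by
  by_cases hs : p ∈ G.support S
  · obtain ⟨e, he, i, hi, hpi⟩ := G.exists_mem_openSegment hp hs
    obtain ⟨κ, hκ, hev⟩ := exists_graphWindingNumber_eq hi hpi he
    have hp0 := sideOf_of_mem_segment (openSegment_subset_segment _ _ _ hpi)
    have hpκ : G.graphWindingNumber S p = κ p := by simpa [hp0] using hev.self_of_nhds
    rw [hpκ]
    have hcl : IsClosed ({0, (ε : ℝ)} : Set ℝ) := (Set.toFinite _).isClosed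
    -- Points to the left of the link have values in the closed set {0, ε}, and the value at `p` is
    -- their limit.
    by_contra hne
    have hne' : κ p ∈ ({0, (ε : ℝ)} : Set ℝ)ᶜ := hne
    obtain ⟨q, hq0, hq1, hq2, hq3⟩ := ((frequently_sideOf_pos (G.pt_ne_pt_succ hi) hp0).and_eventually
      (hev.and ((hκ.eventually (hcl.isOpen_compl.mem_nhds hne')).and
        (G.eventually_mem_support_imp hi hpi)))).exists
    rw [if_neg hq0.not_gt, sub_zero] at hq1
    have hqs : q ∉ G.support S := fun hqs => hq0.ne'
      (sideOf_of_mem_segment (hq3 (Set.biUnion_subset_biUnion_left (Set.subset_univ _) hqs)))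
    exact hq2 (hq1 ▸ h.2 q hqs)
  · exact h.2 p hs

-- The continuous part of the winding number takes integer values near `p`, hence is constant there.
open Classical in
theorem Delimits.eventually_eq (h : G.Delimits S ε) {p : ℂ} {e : E} {i : ℕ} (hi : i < G.len e)
    (hp : p ∈ openSegment ℝ (G.pt e i) (G.pt e (i + 1))) (he : e ∈ S) :
    ∀ᶠ q in 𝓝 p, G.graphWindingNumber S q = G.graphWindingNumber S p -
      (if sideOf (G.pt e i) (G.pt e (i + 1)) q < 0 then 1 else 0) := by
  obtain ⟨κ, hκ, hev⟩ := exists_graphWindingNumber_eq hi hp he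
  have hp0 := sideOf_of_mem_segment (openSegment_subset_segment _ _ _ hp)
  have hpκ : G.graphWindingNumber S p = κ p := by simpa [hp0] using hev.self_of_nhds
  have hK : ∀ᶠ q in 𝓝 p, q ∉ G.corners := by
    exact G.finite_corners.isClosed.isOpen_compl.mem_nhds (G.notMem_corners hi hp)
  have hint : ∀ᶠ q in 𝓝 p, ∃ n : ℤ, κ q = n := by
    filter_upwards [hev, hK] with q hq hqK
    have : ∃ n : ℤ, G.graphWindingNumber S q = n := by
      rcases h.eq_or_eq hqK with h | h
      · exact ⟨0, by simp [h]⟩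
      · exact ⟨ε, h⟩
    obtain ⟨n, hn⟩ := this
    rw [hn, eq_sub_iff_add_eq] at hq
    split_ifs at hq
    · exact ⟨n + 1, by push_cast; exact hq.symm⟩
    · exact ⟨n, by rw [← hq, add_zero]⟩
  filter_upwards [hev, eventually_eq_of_eventually_int hκ hint] with q h1 h2
  rw [h1, h2, hpκ]

/-- The left value w and the right value w − 1 both belong to {0, ε}; this forces w = 1 if ε = 1 and
w = 0 if ε = −1. -/
theorem Delimits.eq_of_mem_openSegment (h : G.Delimits S ε) {p : ℂ} {e : E} {i : ℕ}
    (hi : i < G.len e) (hp : p ∈ openSegment ℝ (G.pt e i) (G.pt e (i + 1))) (he : e ∈ S) :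
    G.graphWindingNumber S p = (1 + ε) / 2 := by
  have hp0 := sideOf_of_mem_segment (openSegment_subset_segment _ _ _ hp)
  have hpK := G.notMem_corners hi hp
  obtain ⟨q, hq0, hq1, hqK⟩ := ((frequently_sideOf_neg (G.pt_ne_pt_succ hi) hp0).and_eventually
    ((h.eventually_eq hi hp he).and (G.finite_corners.isClosed.isOpen_compl.mem_nhds hpK))).exists
  rw [if_pos hq0] at hq1
  have h1 := h.eq_or_eq hpK
  have h2 := h.eq_or_eq hqK
  rw [hq1] at h2
  rcases h.1 with rfl | rfl <;> push_cast at * <;> grind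

/-- Both sides of a link of `S` are visible from each of its inner points. -/
theorem Delimits.frequently_eq (h : G.Delimits S ε) {p : ℂ} {e : E} {i : ℕ}
    (hi : i < G.len e) (hp : p ∈ openSegment ℝ (G.pt e i) (G.pt e (i + 1))) (he : e ∈ S) :
    (∃ᶠ q in 𝓝 p, q ∉ G.support S ∧ G.graphWindingNumber S q = ε) ∧
      ∃ᶠ q in 𝓝 p, q ∉ G.support S ∧ G.graphWindingNumber S q = 0 := by
  have hp0 := sideOf_of_mem_segment (openSegment_subset_segment _ _ _ hp)
  have hev := (h.eventually_eq hi hp he).and (G.eventually_mem_support_imp hi hp)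
  rw [h.eq_of_mem_openSegment hi hp he] at hev
  have hoff : ∀ q, (q ∈ G.support Set.univ → q ∈ segment ℝ (G.pt e i) (G.pt e (i + 1))) →
      sideOf (G.pt e i) (G.pt e (i + 1)) q ≠ 0 → q ∉ G.support S := fun q h1 h2 hqs =>
    h2 (sideOf_of_mem_segment (h1 (Set.biUnion_subset_biUnion_left (Set.subset_univ _) hqs)))
  have hpos := (frequently_sideOf_pos (G.pt_ne_pt_succ hi) hp0).and_eventually hev
  have hneg := (frequently_sideOf_neg (G.pt_ne_pt_succ hi) hp0).and_eventually hev
  have hpos' : ∃ᶠ q in 𝓝 p, q ∉ G.support S ∧ G.graphWindingNumber S q = (1 + ε) / 2 :=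
    hpos.mono fun q ⟨h0, h1, h2⟩ => ⟨hoff q h2 h0.ne', by rw [h1, if_neg h0.not_gt, sub_zero]⟩
  have hneg' : ∃ᶠ q in 𝓝 p, q ∉ G.support S ∧ G.graphWindingNumber S q = (1 + ε) / 2 - 1 :=
    hneg.mono fun q ⟨h0, h1, h2⟩ => ⟨hoff q h2 h0.ne, by rw [h1, if_pos h0]⟩
  -- An anticlockwise circuit has its inside on the left of its links, a clockwise one on the right.
  rcases h.1 with rfl | rfl
  · norm_num at *
    exact ⟨hpos', hneg'⟩
  · norm_num at *
    exact ⟨hneg', hpos'⟩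

end Winding

end PlaneDigraph

/-! ### Constancy on connected sets and along links -/

theorem IsPreconnected.eq_of_forall_int {X : Type*} [TopologicalSpace X] {s : Set X} {f : X → ℝ}
    (hs : IsPreconnected s) (hf : ContinuousOn f s) (h : ∀ x ∈ s, ∃ n : ℤ, f x = n) {x y : X}
    (hx : x ∈ s) (hy : y ∈ s) : f x = f y := by
  wlog hxy : f x ≤ f y generalizing x y
  · exact (this hy hx (le_of_not_ge hxy)).symm
  by_contra hne
  obtain ⟨m, hm⟩ := h x hx
  obtain ⟨n, hn⟩ := h y hy
  have hmn : m + 1 ≤ n := by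
    have := lt_of_le_of_ne hxy hne
    rw [hm, hn, Int.cast_lt] at this
    exact this
  have hmn' : (m : ℝ) + 1 ≤ n := by exact_mod_cast hmn
  -- Between two distinct integers a half-integer would be attained.
  obtain ⟨z, hz, hfz⟩ := (hs.image f hf).ordConnected.out ⟨x, hx, rfl⟩ ⟨y, hy, rfl⟩
    (show (m : ℝ) + 1 / 2 ∈ Set.Icc (f x) (f y) by rw [hm, hn]; constructor <;> linarith)
  obtain ⟨k, hk⟩ := h z hz
  rw [hk] at hfz
  have : (2 * k : ℤ) = 2 * m + 1 := by
    have : (2 * k : ℝ) = 2 * m + 1 := by linarith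
    exact_mod_cast this
  omega

theorem exists_int_of_eq_zero_or_eq {ε : ℤ} {x : ℝ} (hx : x = 0 ∨ x = ε) :
    ∃ n : ℤ, x = n := by
  rcases hx with rfl | rfl
  · exact ⟨0, by simp⟩
  · exact ⟨ε, rfl⟩

namespace PlaneDigraph

variable {V E : Type*} {G : PlaneDigraph V E} [Fintype E] {S : Set E} {ε : ℤ}

theorem Delimits.eq_of_mem_openArc (h : G.Delimits S ε) {e : E} (he : e ∉ S) {p q : ℂ}
    (hp : p ∈ G.openArc e) (hq : q ∈ G.openArc e) :
    G.graphWindingNumber S p = G.graphWindingNumber S q := by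
  have hoff : ∀ z ∈ G.openArc e, z ∉ G.support S := fun z hz hzS => by
    obtain ⟨e', he', hz'⟩ := Set.mem_iUnion₂.1 hzS
    exact G.notMem_arc_of_mem_openArc hz (fun h => he (h ▸ he')) hz'
  exact (G.isPreconnected_openArc e).eq_of_forall_int
    (fun z hz => (G.continuousAt_graphWindingNumber (hoff z hz)).continuousWithinAt)
    (fun z hz => exists_int_of_eq_zero_or_eq (h.2 z (hoff z hz))) hp hq

theorem HasOrientation.delimits {C : List E} (hC : C.Nodup) (h : G.HasOrientation C ε) :
    G.Delimits {e | e ∈ C} ε := by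
  refine ⟨h.1, fun p hp => ?_⟩
  rw [← G.windingNumber_eq hC]
  by_cases h0 : G.windingNumber C p = 0
  · exact Or.inl h0
  · exact Or.inr (h.2.2 p ⟨hp, h0⟩)

/-! ### The region between the circuits -/

section Between

variable {S₁ S₂ I : Set E} {ε₁ ε₂ : ℤ}

/-- The links of `I` together with those links of `S₁` and `S₂` that have the region between `S₁`
and `S₂` on their left. -/
noncomputable def betweenWeight (S₁ S₂ I : Set E) (ε₁ ε₂ : ℤ) (e : E) : ℝ :=
  I.indicator 1 e + (1 - ε₁) / 2 * S₁.indicator 1 e + (1 + ε₂) / 2 * S₂.indicator 1 e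

theorem weightedWinding_betweenWeight (p : ℂ) :
    G.weightedWinding (betweenWeight S₁ S₂ I ε₁ ε₂) p = G.graphWindingNumber I p +
      (1 - ε₁) / 2 * G.graphWindingNumber S₁ p + (1 + ε₂) / 2 * G.graphWindingNumber S₂ p := by
  simp only [graphWindingNumber_eq, weightedWinding, betweenWeight, add_mul,
    Finset.sum_add_distrib, mul_assoc, ← Finset.mul_sum]
  ring

/-- Values on links are limits from the left, so the left-hand side tells whether the region lies to
the left of `e`. A link of `S₁` is inside `S₂` and sees the region on its outer side; a link of `S₂`
is outside `S₁` and sees it on its inner side; any other link runs entirely in the region or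
entirely off it. -/
theorem sub_eq_betweenWeight (h₁ : G.Delimits S₁ ε₁) (h₂ : G.Delimits S₂ ε₂)
    (hdisj : Disjoint S₁ S₂)
    (hnest : ∀ p ∉ G.support S₁, G.graphWindingNumber S₁ p ≠ 0 →
      p ∉ G.support S₂ ∧ G.graphWindingNumber S₂ p ≠ 0)
    (hI : ∀ e, e ∈ I ↔ ∀ p ∈ G.openArc e,
      (p ∉ G.support S₁ ∧ G.graphWindingNumber S₁ p = 0) ∧
        p ∉ G.support S₂ ∧ G.graphWindingNumber S₂ p ≠ 0)
    {p : ℂ} {e : E} {i : ℕ} (hi : i < G.len e)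
    (hp : p ∈ openSegment ℝ (G.pt e i) (G.pt e (i + 1))) :
    ε₂ * G.graphWindingNumber S₂ p - ε₁ * G.graphWindingNumber S₁ p =
      betweenWeight S₁ S₂ I ε₁ ε₂ e := by
  have hpA := G.mem_openArc hi hp
  have hsq : ∀ {ε : ℤ}, ε = 1 ∨ ε = -1 → (ε * ε : ℝ) = 1 := by
    rintro ε (rfl | rfl) <;> simp
  have hsq₁ := hsq h₁.1
  have hsq₂ := hsq h₂.1
  by_cases he₁ : e ∈ S₁
  · have he₂ : e ∉ S₂ := Set.disjoint_left.1 hdisj he₁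
    have heI : e ∉ I := fun h => ((hI e).1 h p hpA).1.1 (G.mem_support hi hp he₁)
    have hpS := G.notMem_support hi hp he₂
    -- Points inside `S₁` accumulate at `p`. They are inside `S₂`, whose winding number is constant
    -- near `p`.
    obtain ⟨q, ⟨hq1, hq2⟩, hq3⟩ := ((h₁.frequently_eq hi hp he₁).1.and_eventually
      (h₂.eventually_eq_of_notMem hpS)).exists
    have hne := (hnest q hq1 (by rw [hq2]; intro h; rw [h] at hsq₁; simp at hsq₁)).2
    rw [hq3] at hne
    rw [(h₂.2 p hpS).resolve_left hne, h₁.eq_of_mem_openSegment hi hp he₁, hsq₂]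
    simp [betweenWeight, he₁, he₂, heI]
    linear_combination (-1 / 2) * hsq₁
  · have hpS₁ := G.notMem_support hi hp he₁
    by_cases he₂ : e ∈ S₂
    · have heI : e ∉ I := fun h => ((hI e).1 h p hpA).2.1 (G.mem_support hi hp he₂)
      have h0 : G.graphWindingNumber S₁ p = 0 := by
        by_contra hne
        -- Were `p` inside `S₁`, so would be nearby points outside `S₂`, against nesting.
        obtain ⟨q, ⟨hq1, hq2⟩, hq3, hq4⟩ := ((h₂.frequently_eq hi hp he₂).2.and_eventually
          ((h₁.eventually_eq_of_notMem hpS₁).and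
            ((G.isClosed_support S₁).isOpen_compl.mem_nhds hpS₁))).exists
        exact (hnest q hq4 (hq3 ▸ hne)).2 hq2
      rw [h0, h₂.eq_of_mem_openSegment hi hp he₂]
      simp [betweenWeight, he₁, he₂, heI]
      linear_combination (1 / 2) * hsq₂
    · have hpS₂ := G.notMem_support hi hp he₂
      by_cases heI : e ∈ I
      · obtain ⟨⟨-, h0⟩, -, hne⟩ := (hI e).1 heI p hpA
        rw [h0, (h₂.2 p hpS₂).resolve_left hne]
        simp [betweenWeight, he₁, he₂, heI, hsq₂]
      · simp only [betweenWeight, he₁, he₂, heI, not_false_eq_true, Set.indicator_of_notMem,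
          mul_zero, add_zero]
        by_cases h0 : G.graphWindingNumber S₁ p = 0
        · by_cases h0' : G.graphWindingNumber S₂ p = 0
          · simp [h0, h0']
          · refine absurd ((hI e).2 fun z hz => ?_) heI
            have hoff : ∀ {S : Set E}, e ∉ S → z ∉ G.support S := fun he hzS => by
              obtain ⟨e', he', hz'⟩ := Set.mem_iUnion₂.1 hzS
              exact G.notMem_arc_of_mem_openArc hz (fun h => he (h ▸ he')) hz'
            rw [h₁.eq_of_mem_openArc he₁ hz hpA, h₂.eq_of_mem_openArc he₂ hz hpA]
            exact ⟨⟨hoff he₁, h0⟩, hoff he₂, h0'⟩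
        · rw [(h₁.2 p hpS₁).resolve_left h0,
            (h₂.2 p hpS₂).resolve_left (hnest p hpS₁ h0).2, hsq₁, hsq₂, sub_self]

theorem graphWindingNumber_between_eq (hface : G.FacesOriented)
    (h₁ : G.Delimits S₁ ε₁) (h₂ : G.Delimits S₂ ε₂) (hdisj : Disjoint S₁ S₂)
    (hnest : ∀ p ∉ G.support S₁, G.graphWindingNumber S₁ p ≠ 0 →
      p ∉ G.support S₂ ∧ G.graphWindingNumber S₂ p ≠ 0)
    (hI : ∀ e, e ∈ I ↔ ∀ p ∈ G.openArc e,
      (p ∉ G.support S₁ ∧ G.graphWindingNumber S₁ p = 0) ∧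
        p ∉ G.support S₂ ∧ G.graphWindingNumber S₂ p ≠ 0)
    {p : ℂ} (hp : p ∉ G.corners) :
    G.graphWindingNumber I p =
      G.leftIndicator p * (ε₂ * G.graphWindingNumber S₂ p - ε₁ * G.graphWindingNumber S₁ p) -
        (1 - ε₁) / 2 * G.graphWindingNumber S₁ p - (1 + ε₂) / 2 * G.graphWindingNumber S₂ p := by
  classical
  suffices G.weightedWinding (betweenWeight S₁ S₂ I ε₁ ε₂) p = G.leftIndicator p *
      (ε₂ * G.graphWindingNumber S₂ p - ε₁ * G.graphWindingNumber S₁ p) by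
    rw [← this, weightedWinding_betweenWeight]; ring
  have hle : ∀ q x, |G.leftIndicator q * x| ≤ |x| := fun q x => by
    rw [abs_mul]
    exact mul_le_of_le_one_left (abs_nonneg _) (G.abs_leftIndicator_le q)
  have hdiff : ∀ q, ε₂ * G.graphWindingNumber S₂ q - ε₁ * G.graphWindingNumber S₁ q =
      ε₂ * G.weightedWinding (S₂.indicator 1) q - ε₁ * G.weightedWinding (S₁.indicator 1) q :=
    fun q => by rw [graphWindingNumber_eq, graphWindingNumber_eq]
  refine G.weightedWinding_eq_of_jump _ (fun q => G.leftIndicator q *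
      (ε₂ * G.graphWindingNumber S₂ q - ε₁ * G.graphWindingNumber S₁ q)) ?_ ?_ ?_ ?_ hp
  · obtain ⟨A, hA⟩ := G.exists_abs_weightedWinding_le (S₁.indicator 1)
    obtain ⟨B, hB⟩ := G.exists_abs_weightedWinding_le (S₂.indicator 1)
    refine ⟨|(ε₂ : ℝ)| * B + |(ε₁ : ℝ)| * A, fun q => (hle _ _).trans ?_⟩
    rw [hdiff]
    refine (abs_sub _ _).trans ?_
    rw [abs_mul, abs_mul]
    gcongr
    · exact hB q
    · exact hA q
  · have := ((G.tendsto_weightedWinding (S₂.indicator 1)).const_mul (ε₂ : ℝ)).sub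
      ((G.tendsto_weightedWinding (S₁.indicator 1)).const_mul (ε₁ : ℝ))
    rw [mul_zero, mul_zero, sub_zero] at this
    refine squeeze_zero_norm (fun q => ?_) (tendsto_zero_iff_norm_tendsto_zero.1 this)
    rw [hdiff]
    exact hle _ _
  · intro q hq
    have hS : ∀ S : Set E, q ∉ G.support S := fun S h =>
      hq (Set.biUnion_subset_biUnion_left (Set.subset_univ _) h)
    filter_upwards [G.eventually_leftIndicator_eq hq, h₁.eventually_eq_of_notMem (hS S₁),
      h₂.eventually_eq_of_notMem (hS S₂)] with z hz1 hz2 hz3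
    rw [hz1, hz2, hz3]
  · intro e i hi q hq
    have hl := G.eventually_leftIndicator_eq_ite hface hi hq
    have hq0 := sideOf_of_mem_segment (openSegment_subset_segment _ _ _ hq)
    have hlq : G.leftIndicator q = 1 := by simpa [hq0] using hl.self_of_nhds
    -- Constancy is needed only on the left: on the right the factor `leftIndicator` is 0, so the
    -- product drops by its full value at the link.
    have hu : ∀ {S : Set E} {ε : ℤ}, G.Delimits S ε → ∀ᶠ z in 𝓝 q,
        ¬ sideOf (G.pt e i) (G.pt e (i + 1)) z < 0 →
          G.graphWindingNumber S z = G.graphWindingNumber S q := fun {S ε} h => by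
      by_cases he : e ∈ S
      · filter_upwards [h.eventually_eq hi hq he] with z hz hz0
        rw [hz, if_neg hz0, sub_zero]
      · filter_upwards [h.eventually_eq_of_notMem (G.notMem_support hi hq he)] with z hz _ using hz
    filter_upwards [hl, hu h₁, hu h₂] with z hz hz1 hz2
    rw [hz, hlq, ← sub_eq_betweenWeight h₁ h₂ hdisj hnest hI hi hq]
    split_ifs with h
    · ring
    · rw [hz1 h, hz2 h]; ring

theorem graphWindingNumber_between_eq_of_face (hface : G.FacesOriented)
    (h₁ : G.Delimits S₁ ε₁) (h₂ : G.Delimits S₂ ε₂) (hdisj : Disjoint S₁ S₂)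
    (hnest : ∀ p ∉ G.support S₁, G.graphWindingNumber S₁ p ≠ 0 →
      p ∉ G.support S₂ ∧ G.graphWindingNumber S₂ p ≠ 0)
    (hI : ∀ e, e ∈ I ↔ ∀ p ∈ G.openArc e,
      (p ∉ G.support S₁ ∧ G.graphWindingNumber S₁ p = 0) ∧
        p ∉ G.support S₂ ∧ G.graphWindingNumber S₂ p ≠ 0)
    {F : Set ℂ} (hF : G.IsFace I F) {q : ℂ} (hqF : q ∈ F) (hqS : q ∉ G.support S₁)
    (hq : G.graphWindingNumber S₁ q ≠ 0) {p : ℂ} (hp : p ∈ F) :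
    G.graphWindingNumber I p = -(ε₁ + ε₂) / 2 := by
  obtain ⟨p₀, -, rfl⟩ := hF
  have hopen : IsOpen (connectedComponentIn (G.support I)ᶜ p₀) :=
    (G.isClosed_support I).isOpen_compl.connectedComponentIn
  have hsub : ∀ z ∈ connectedComponentIn (G.support I)ᶜ p₀, z ∉ G.support I :=
    fun z hz => connectedComponentIn_subset _ _ hz
  have hfreq : ∀ z, ∃ᶠ w in 𝓝 z, w ∉ G.corners := fun z =>
    mem_closure_iff_frequently.1 (G.finite_corners.countable.dense_compl ℝ z)
  have hform := fun z hz => graphWindingNumber_between_eq hface h₁ h₂ hdisj hnest hI (p := z) hz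
  -- The face may contain corners of links outside `I`, where the formula is not available; there
  -- the value is a limit of integers.
  have hint : ∀ z ∈ connectedComponentIn (G.support I)ᶜ p₀,
      ∃ n : ℤ, G.graphWindingNumber I z = n := by
    intro z hz
    have hcl : IsClosed (Set.range ((↑) : ℤ → ℝ)) := Int.isClosedEmbedding_coe_real.isClosed_range
    by_contra hne
    have hne' : G.graphWindingNumber I z ∈ (Set.range ((↑) : ℤ → ℝ))ᶜ := fun ⟨n, hn⟩ =>
      hne ⟨n, hn.symm⟩
    obtain ⟨w, hwK, hw⟩ := ((hfreq z).and_eventually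
      ((G.continuousAt_graphWindingNumber (hsub z hz)).eventually
        (hcl.isOpen_compl.mem_nhds hne'))).exists
    obtain ⟨a, ha⟩ := exists_int_of_eq_zero_or_eq (h₁.eq_or_eq hwK)
    obtain ⟨b, hb⟩ := exists_int_of_eq_zero_or_eq (h₂.eq_or_eq hwK)
    obtain ⟨l, hl⟩ : ∃ l : ℤ, G.leftIndicator w = l := by
      unfold leftIndicator
      split_ifs
      · exact ⟨1, by simp⟩
      · exact ⟨0, by simp⟩
    obtain ⟨s, hs⟩ : ∃ s : ℤ, ((1 : ℝ) - ε₁) / 2 = s := by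
      rcases h₁.1 with h | h
      · exact ⟨0, by simp [h]⟩
      · exact ⟨1, by norm_num [h]⟩
    obtain ⟨t, ht⟩ : ∃ t : ℤ, ((1 : ℝ) + ε₂) / 2 = t := by
      rcases h₂.1 with h | h
      · exact ⟨1, by norm_num [h]⟩
      · exact ⟨0, by simp [h]⟩
    refine hw ⟨l * (ε₂ * b - ε₁ * a) - s * a - t * b, ?_⟩
    rw [hform w hwK, ha, hb, hl, hs, ht]
    push_cast
    ring
  obtain ⟨hqS₂, hq₂⟩ := hnest q hqS hq
  -- The point `q` may be a corner; a nearby `w` off the corners lies in the same face and has the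
  -- same two winding numbers, ε₁ and ε₂.
  obtain ⟨w, hwK, hwF, hw1, hw2⟩ := ((hfreq q).and_eventually ((hopen.eventually_mem hqF).and
    ((h₁.eventually_eq_of_notMem hqS).and (h₂.eventually_eq_of_notMem hqS₂)))).exists
  rw [(h₁.2 q hqS).resolve_left hq] at hw1
  rw [(h₂.2 q hqS₂).resolve_left hq₂] at hw2
  rw [isPreconnected_connectedComponentIn.eq_of_forall_int
    (fun z hz => (G.continuousAt_graphWindingNumber (hsub z hz)).continuousWithinAt) hint hp hwF,
    hform w hwK, hw1, hw2]
  rcases h₁.1 with rfl | rfl <;> rcases h₂.1 with rfl | rfl <;> norm_num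

end Between

end PlaneDigraph

/-! ### Circulation around the central face -/

theorem mainTheorem1 {V E : Type*} [Finite V] [Fintype E] (G : PlaneDigraph V E)
    (hbal : G.IsBalanced) (hface : G.FacesOriented)
    (C₁ C₂ : List E) (hC₁ : G.IsCircuit C₁) (hC₂ : G.IsCircuit C₂)
    (ε₁ ε₂ : ℤ) (hε₁ : G.HasOrientation C₁ ε₁) (hε₂ : G.HasOrientation C₂ ε₂)
    (hdisj : List.Disjoint C₁ C₂) (hnested : G.inside C₁ ⊆ G.inside C₂)
    (F : Set ℂ) (hF : G.IsCentralFace C₁ C₂ F) :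
    (ε₁ = ε₂ → ∀ p ∈ F,
      G.graphWindingNumber (G.interface C₁ C₂) p = -(ε₁ : ℝ) ∧
      ∀ γ, G.IsEulerianCircuit (G.interface C₁ C₂) γ → G.windingNumber γ p = -(ε₁ : ℝ)) ∧
    (ε₁ = -ε₂ → ∀ p ∈ F,
      G.graphWindingNumber (G.interface C₁ C₂) p = 0 ∧
      ∀ γ, G.IsEulerianCircuit (G.interface C₁ C₂) γ → G.windingNumber γ p = 0) := by
  have hW₁ := G.windingNumber_eq hC₁.1
  have hW₂ := G.windingNumber_eq hC₂.1
  obtain ⟨hFace, q, hqF, hqS, hq⟩ := hF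
  have key : ∀ p ∈ F, G.graphWindingNumber (G.interface C₁ C₂) p = -(ε₁ + ε₂) / 2 := by
    intro p hp
    refine PlaneDigraph.graphWindingNumber_between_eq_of_face hface (hε₁.delimits hC₁.1)
      (hε₂.delimits hC₂.1) (Set.disjoint_left.2 fun e h h' => hdisj h h') ?_ ?_ hFace hqF hqS
      (hW₁ q ▸ hq) hp
    · intro z hz hz0
      rw [← hW₁] at hz0
      rw [← hW₂]
      exact hnested ⟨hz, hz0⟩
    · intro e
      simp only [← hW₁, ← hW₂]
      rfl
  have hEuler : ∀ p γ, G.IsEulerianCircuit (G.interface C₁ C₂) γ →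
      G.windingNumber γ p = G.graphWindingNumber (G.interface C₁ C₂) p := by
    rintro p γ ⟨hγ, hmem⟩
    rw [G.windingNumber_eq hγ.1, show {e | e ∈ γ} = G.interface C₁ C₂ from Set.ext hmem]
  refine ⟨fun h p hp => ?_, fun h p hp => ?_⟩
  · have : G.graphWindingNumber (G.interface C₁ C₂) p = -(ε₁ : ℝ) := by
      rw [key p hp, h]; ring
    exact ⟨this, fun γ hγ => (hEuler p γ hγ).trans this⟩
  · have : G.graphWindingNumber (G.interface C₁ C₂) p = 0 := by
      rw [key p hp, h]; push_cast; ring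
    exact ⟨this, fun γ hγ => (hEuler p γ hγ).trans this⟩
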